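/- **Setting.** A team of $p\ge 1$ robots, $V=\{1,\dots,p\}$, communicates at time $t=0,1,2,\dots$ over a directed graph $\mathcal G(t)=(V,E(t))$ with weighted adjacency matrix $A(t)=[a_{ij,t}]$, i.e. for $i\ne j$, $a_{ij,t}\neq 0$ if and only if $(i,j)\in E(t)$; let $\mathbb N_{i,t}=\{j\neq i:(i,j)\in E(t)\}$. Let $\mathcal X\subset\mathbb R^{n}$ and let $\kappa:\mathcal X\times\mathcal X\to\mathbb R$ be a covariance kernel (symmetric, positive semidefinite) with $\kappa(\mathbf x,\mathbf x)\le\sigma_f^2$ for all $\mathbf x$ (for example the squared exponential kernel $\sigma_f^2\exp(-\|\mathbf x-\mathbf x'\|^2/\ell^2)$). Let $\sigma_e,\sigma_f,\sigma_n>0$. Robot $i$ receives the data $(\mathbf x_{i,t},y_{i,t})\in\mathcal X\times\mathbb R$, $t\ge1$, and runs the recursive Gaussian process update with noise variance $\sigma_e^2$: with $\mathbf X_t=(\mathbf x_{1},\dots,\mathbf x_{t})$ its inputs so far (index $i$ omitted), $\alpha_0$ and $C_0$ empty, $k=K(\mathbf X_t,\mathbf x_{t+1})$ and $d=\sigma_e^2+\kappa(\mathbf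 x_{t+1},\mathbf x_{t+1})+k^{T}C_tk$, $$\alpha_{t+1}=\begin{bmatrix}\alpha_t\\0\end{bmatrix}+\frac{y_{t+1}-k^{T}\alpha_t}{d}\,s,\qquad C_{t+1}=\begin{bmatrix}C_t&0\\0&0\end{bmatrix}-\frac1d\,ss^{T},\qquad s=\begin{bmatrix}C_tk\\1\end{bmatrix}.$$ Its local mean and variance at a test point $\mathbf x^*\in\mathcal X$ are $\mu^{[L]}_{i,t}(\mathbf x^*)=K(\mathbf x^*,\mathbf X_t)\alpha_t$ and $\Sigma^{[L]}_{i,t}(\mathbf x^*)=\kappa(\mathbf x^*,\mathbf x^*)+K(\mathbf x^*,\mathbf X_t)C_tK(\mathbf X_t,\mathbf x^*)$, and $\hat\Sigma_{i,t}=\Sigma^{[L]}_{i,t}+\sigma_n^2$. At each test point put $\mathbf r_{i,t}=\big(\mu^{[L]}_{i,t}/\hat\Sigma_{i,t},\;1/\hat\Sigma_{i,t}\big)$, $\Delta\mathbf r_{i,0}=0$, $\Delta\mathbf r_{i,t}=\mathbf r_{i,t}-\mathbf r_{i,t-1}$, and run the first-order dynamic average consensus $$\xi_{i,t+1}=\xi_{i,t}+\sum_{j\in\mathbb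 N_{i,t}}a_{ij,t}(\xi_{j,t}-\xi_{i,t})+\Delta\mathbf r_{i,t},\qquad \xi_{i,0}=\mathbf r_{i,0}.$$ The distributed mean is $\mu^{[D]}_{i,t}=\xi^{[1]}_{i,t+1}/\xi^{[2]}_{i,t+1}$ and the centralized product-of-experts mean is $\tilde\mu_t=\sum_{i=1}^p\frac{\hat\Sigma_{i,t}^{-1}}{\sum_{k=1}^p\hat\Sigma_{k,t}^{-1}}\,\mu^{[L]}_{i,t}$. **Assumptions.** (1) There is an integer $B\ge1$ such that for every $t\ge1$ the graph $(V,E(t)\cup\dots\cup E(t+B-1))$ is strongly connected. (2) There is $\varphi>0$ such that for all $t\ge1$ and all $i$: $a_{ii,t}=1-\sum_{j\in\mathbb N_{i,t}}a_{ij,t}\ge\varphi$, $a_{ij,t}\in\{0\}\cup[\varphi,1]$ for $j\in\mathbb N_{i,t}$, and $\mathbf 1^{T}A(t)=\mathbf 1^{T}$, $A(t)\mathbf 1=\mathbf 1$. (3) There are constants $\bar y,\bar\mu$ with $|y_{i,t}|\le\bar y$ and $|\mu^{[L]}_{i,t}(\mathbf x^*)|\le\bar\mu$ for all $t\ge1$,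 $i\in V$, $\mathbf x^*\in\mathcal X$. **Theorem.** Let $$\hat\delta_1=\frac{\bar y\,\sigma_f^2(\sigma_n^2+\sigma_f^2)}{\sigma_n^2(\sigma_e^2+\sigma_f^2)}+\frac{\bar\mu\,\sigma_f^4}{\sigma_n^2(\sigma_e^2+\sigma_f^2)},\qquad \hat\delta_2=\frac{\sigma_f^4}{\sigma_n^2(\sigma_e^2+\sigma_f^2)},\qquad \eta=\frac{4(pB-1)}{\varphi^{\frac12p(p+1)B-1}},$$ and suppose $\sigma_n^2\ge\dfrac{\eta\,\sigma_f^4}{\sigma_e^2+\sigma_f^2}$. Then for every $i\in V$ and $\mathbf x^*\in\mathcal X$ the limit of $\big|\mu^{[D]}_{i,t}(\mathbf x^*)-\tilde\mu_t(\mathbf x^*)\big|$ as $t\to\infty$ exists and satisfies $$\lim_{s\to\infty}\big|\mu^{[D]}_{i,s}(\mathbf x^*)-\tilde\mu_s(\mathbf x^*)\big|\;\le\;\alpha+\beta\,|\tilde\mu_t(\mathbf x^*)|\quad\text{for all sufficiently large }t,\qquad \alpha=\frac{\eta\hat\delta_1}{1+\eta\hat\delta_2},\quad \beta=\left|\frac{\eta\hat\delta_2}{1-\eta\hat\delta_2}\right|,$$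 where in the borderline case $\eta\hat\delta_2=1$ one reads $\beta=+\infty$ and the bound is void. Furthermore, for every $\mathbf x^*\in\mathcal X$, if there is a constant $h>0$ such that $\Delta\mathbf r_{i,t+1}(\mathbf x^*)=0$ for all $t>h$ and all $i\in V$, then $\mu^{[D]}_{i,t}(\mathbf x^*)-\tilde\mu_t(\mathbf x^*)\to0$ as $t\to\infty$ for every $i\in V$. -/

import Mathlib

open Filter Topology Matrix

noncomputable section

/-! ### Recursive Gaussian process regression -/

namespace RecursiveGP

variable {S : Type*}

/-- `K(X_t, x')`: the vector of kernel values between the first `t` inputs `x_1, …, x_t`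
(the value `x 0` is never used) and the point `x'`. -/
def gramVec (κ : S → S → ℝ) (x : ℕ → S) (t : ℕ) (x' : S) : Fin t → ℝ :=
  fun k => κ (x (k + 1)) x'

/-- The vector `[v ; c]`. -/
def appendEntry {t : ℕ} (v : Fin t → ℝ) (c : ℝ) : Fin (t + 1) → ℝ :=
  Fin.snoc (α := fun _ => ℝ) v c

/-- The block matrix `[[M, 0], [0, 0]]`, with one zero row and one zero column added. -/
def padMatrix {t : ℕ} (M : Matrix (Fin t) (Fin t) ℝ) : Matrix (Fin (t + 1)) (Fin (t + 1)) ℝ :=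
  Matrix.of (Fin.snoc (α := fun _ => Fin (t + 1) → ℝ) (fun i => appendEntry (M i) 0) 0)

/-- The variables `(α_t, C_t)` of the recursive Gaussian process update for the data
`(x_1, y_1), (x_2, y_2), …` and noise variance `σe²`; before the first datum both are empty. -/
def state (κ : S → S → ℝ) (σe : ℝ) (x : ℕ → S) (y : ℕ → ℝ) :
    (t : ℕ) → (Fin t → ℝ) × Matrix (Fin t) (Fin t) ℝ
  | 0 => (0, 0)
  | t + 1 =>
    let a : Fin t → ℝ := (state κ σe x y t).1
    let C : Matrix (Fin t) (Fin t) ℝ := (state κ σe x y t).2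
    let k : Fin t → ℝ := gramVec κ x t (x (t + 1))
    let d : ℝ := σe ^ 2 + κ (x (t + 1)) (x (t + 1)) + k ⬝ᵥ (C *ᵥ k)
    let q : ℝ := (y (t + 1) - k ⬝ᵥ a) / d
    let r : ℝ := -1 / d
    let s : Fin (t + 1) → ℝ := appendEntry (C *ᵥ k) 1
    (appendEntry a 0 + q • s, padMatrix C + r • Matrix.vecMulVec s s)

/-- Predictive mean `μ_t(x') = K(x', X_t) α_t`. -/
def mean (κ : S → S → ℝ) (σe : ℝ) (x : ℕ → S) (y : ℕ → ℝ) (t : ℕ) (x' : S) : ℝ :=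
  gramVec κ x t x' ⬝ᵥ (state κ σe x y t).1

/-- Predictive variance `Σ_t(x') = κ(x', x') + K(x', X_t) C_t K(X_t, x')`. -/
def variance (κ : S → S → ℝ) (σe : ℝ) (x : ℕ → S) (y : ℕ → ℝ) (t : ℕ) (x' : S) : ℝ :=
  κ x' x' + gramVec κ x t x' ⬝ᵥ ((state κ σe x y t).2 *ᵥ gramVec κ x t x')

/-- Corrected variance `Σ_t(x') + σn²`. -/
def corrVariance (κ : S → S → ℝ) (σe σn : ℝ) (x : ℕ → S) (y : ℕ → ℝ) (t : ℕ) (x' : S) : ℝ :=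
  variance κ σe x y t x' + σn ^ 2

end RecursiveGP

/-! ### Time-varying directed networks -/

namespace Network

variable {p : ℕ}

open Classical in
/-- The neighbours of node `i` (the node itself never counts). -/
def neighbors (G : Digraph (Fin p)) (i : Fin p) : Finset (Fin p) :=
  Finset.univ.filter fun j => j ≠ i ∧ G.Adj i j

/-- The off-diagonal support of `A` is the edge set of `G`. -/
def IsWeightedAdjacency (G : Digraph (Fin p)) (A : Matrix (Fin p) (Fin p) ℝ) : Prop :=
  ∀ i j, i ≠ j → (G.Adj i j ↔ A i j ≠ 0)

/-- Every node reaches every node along a directed path. -/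
def StronglyConnected (G : Digraph (Fin p)) : Prop :=
  ∀ i j, Relation.ReflTransGen G.Adj i j

/-- For every `t ≥ 1` the union of the graphs at times `t, …, t + B - 1` is strongly connected. -/
def PeriodicallyStronglyConnected (G : ℕ → Digraph (Fin p)) (B : ℕ) : Prop :=
  ∀ t, 1 ≤ t → StronglyConnected (p := p) ⟨fun i j => ∃ k, k < B ∧ (G (t + k)).Adj i j⟩

/-- Non-degeneracy of the weights with constant `φ`, from time `1` on. -/
def NonDegenerate (G : ℕ → Digraph (Fin p)) (A : ℕ → Matrix (Fin p) (Fin p) ℝ) (φ : ℝ) : Prop :=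
  ∀ t, 1 ≤ t → ∀ i,
    A t i i = 1 - ∑ j ∈ neighbors (G t) i, A t i j ∧ φ ≤ A t i i ∧
    ∀ j ∈ neighbors (G t) i, A t i j = 0 ∨ A t i j ∈ Set.Icc φ 1

/-- Column and row sums of the weight matrices are `1`, from time `1` on. -/
def DoublyStochastic (A : ℕ → Matrix (Fin p) (Fin p) ℝ) : Prop :=
  ∀ t, 1 ≤ t → (1 : Fin p → ℝ) ᵥ* A t = 1 ∧ A t *ᵥ (1 : Fin p → ℝ) = 1

end Network

/-! ### Dynamic average consensus and aggregation at one test point -/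

namespace Aggregation

variable {p : ℕ}

/-- The increments `Δr_t = r_t - r_{t-1}` of a reference signal, with `Δr_0 = 0`. -/
def increment (r : ℕ → Fin p → Fin 2 → ℝ) : ℕ → Fin p → Fin 2 → ℝ
  | 0 => 0
  | t + 1 => r (t + 1) - r t

/-- First-order dynamic average consensus on the reference signal `r`, started at `ξ_0 = r_0`. -/
def consensus (G : ℕ → Digraph (Fin p)) (A : ℕ → Matrix (Fin p) (Fin p) ℝ)
    (r : ℕ → Fin p → Fin 2 → ℝ) : ℕ → Fin p → Fin 2 → ℝ
  | 0 => r 0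
  | t + 1 => fun i =>
      consensus G A r t i
        + ∑ j ∈ Network.neighbors (G t) i,
            A t i j • (consensus G A r t j - consensus G A r t i)
        + increment r t i

variable {S : Type*}

/-- The reference signal `r_{i,t} = (μ_{i,t} / Σ̂_{i,t}, 1 / Σ̂_{i,t})` at the test point `x'`, where
robot `i` holds the data `(x i k, y i k)`, `k ≥ 1`. -/
def reference (κ : S → S → ℝ) (σe σn : ℝ) (x : Fin p → ℕ → S) (y : Fin p → ℕ → ℝ) (x' : S) :
    ℕ → Fin p → Fin 2 → ℝ :=
  fun t i =>
    ![RecursiveGP.mean κ σe (x i) (y i) t x'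
        * (RecursiveGP.corrVariance κ σe σn (x i) (y i) t x')⁻¹,
      (RecursiveGP.corrVariance κ σe σn (x i) (y i) t x')⁻¹]

/-- The distributed mean of robot `i` at time `t`: the quotient of the two entries of `ξ_{i,t+1}`. -/
def distMean (G : ℕ → Digraph (Fin p)) (A : ℕ → Matrix (Fin p) (Fin p) ℝ)
    (κ : S → S → ℝ) (σe σn : ℝ) (x : Fin p → ℕ → S) (y : Fin p → ℕ → ℝ)
    (i : Fin p) (t : ℕ) (x' : S) : ℝ :=
  consensus G A (reference κ σe σn x y x') (t + 1) i 0
    * (consensus G A (reference κ σe σn x y x') (t + 1) i 1)⁻¹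

/-- The centralized product-of-experts mean at time `t`. -/
def poeMean (κ : S → S → ℝ) (σe σn : ℝ) (x : Fin p → ℕ → S) (y : Fin p → ℕ → ℝ)
    (t : ℕ) (x' : S) : ℝ :=
  ∑ i, (RecursiveGP.corrVariance κ σe σn (x i) (y i) t x')⁻¹
      / (∑ k, (RecursiveGP.corrVariance κ σe σn (x k) (y k) t x')⁻¹)
    * RecursiveGP.mean κ σe (x i) (y i) t x'

/-! ### The constants of the error bound -/

/-- `η = 4 (p B - 1) / φ ^ (p (p + 1) B / 2 - 1)`. -/
def eta (p B : ℕ) (φ : ℝ) : ℝ :=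
  4 * ((p : ℝ) * B - 1) / φ ^ (0.5 * (p : ℝ) * (p + 1) * B - 1 : ℝ)

/-- The constant `δ̂₁`. -/
def delta₁ (σe σf σn ybar mubar : ℝ) : ℝ :=
  ybar * σf ^ 2 * (σn ^ 2 + σf ^ 2) / (σn ^ 2 * (σe ^ 2 + σf ^ 2))
    + mubar * σf ^ 4 / (σn ^ 2 * (σe ^ 2 + σf ^ 2))

/-- The constant `δ̂₂`. -/
def delta₂ (σe σf σn : ℝ) : ℝ :=
  σf ^ 4 / (σn ^ 2 * (σe ^ 2 + σf ^ 2))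

/-- `α = η δ̂₁ / (1 + η δ̂₂)`. -/
def alphaBound (η δ₁ δ₂ : ℝ) : ℝ := η * δ₁ / (1 + η * δ₂)

/-- `β = |η δ̂₂ / (1 - η δ̂₂)|`. -/
def betaBound (η δ₂ : ℝ) : ℝ := |η * δ₂ / (1 - η * δ₂)|

end Aggregation

end

/-! The gap between distributed and centralized means always tends to zero, because the local
Gaussian processes settle down by themselves. The asserted error bound then only needs its
right-hand side to be nonnegative, and the statement on vanishing inputs is a special case.

Each datum replaces the posterior covariance by its Schur complement at the new input
(`covariance_succ`, `Matrix.PosSemidef.condition`). Posterior variances at a fixed test point are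
therefore nonincreasing and nonnegative, hence convergent. The drop at each step is the squared
covariance between test point and new input, divided by a bounded denominator. So this covariance
tends to zero (`tendsto_covariance_input`). The mean moves by a bounded multiple of it, so its
increments vanish too, although the mean itself need not converge. Hence the increments of the
reference signal tend to zero.

Consensus driven by vanishing increments tracks the network average. The deviation from the average
is a zero-sum vector, and products of `p * B` successive weight matrices contract such vectors in
the sup norm by a fixed factor below 1 (`pow_le_transition`, `norm_mulVec_le_of_zero_sum`). The
second average has a positive limit, so the quotient of the two consensus components may be compared
with the quotient of the averages, which is the product-of-experts mean. -/

/-- Conditioning a positive semidefinite kernel on a noisy observation at `v` preserves positive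
semidefiniteness. -/
theorem Matrix.PosSemidef.condition {S : Type*} {K : Matrix S S ℝ} (hK : K.PosSemidef)
    (v : S) {s : ℝ} (hs : 0 < s) :
    (Matrix.of fun i j => K i j - K i v * K v j / (s + K v v)).PosSemidef := by
  have hsymm : ∀ i j, K i j = K j i := fun i j => by simpa using hK.1.apply j i
  have hv : 0 ≤ K v v := hK.diag_nonneg
  have hd : 0 < s + K v v := by linarith
  refine ⟨?_, fun c => ?_⟩
  · ext i j
    simp only [Matrix.conjTranspose_apply, Matrix.of_apply, star_trivial]
    rw [hsymm j i, hsymm j v, hsymm v i]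
    ring
  · set b : ℝ := c.sum fun i ci => K v i * ci with hb
    set q : ℝ := c.sum fun i ci => c.sum fun j cj => ci * K i j * cj with hq
    have hb' : (c.sum fun i ci => ci * K i v) = b :=
      Finsupp.sum_congr fun i _ => by rw [hsymm i v, mul_comm]
    -- This is the quadratic form of `K` at `c + l δ_v`.
    have expand : ∀ l : ℝ, 0 ≤ q + 2 * l * b + l ^ 2 * K v v := by
      intro l
      have h := hK.2 (c + Finsupp.single v l)
      simp only [star_trivial] at h
      have inner : ∀ i (ci : ℝ), ((c + Finsupp.single v l).sum fun j cj => ci * K i j * cj)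
          = (c.sum fun j cj => ci * K i j * cj) + ci * K i v * l := by
        intro i ci
        rw [Finsupp.sum_add_index' (by simp) (by intros; ring), Finsupp.sum_single_index (by simp)]
      simp only [inner] at h
      rw [Finsupp.sum_add_index' (by simp)
        (by
          intro i a a'
          simp only [add_mul, Finsupp.sum_add]
          ring), Finsupp.sum_single_index (by simp), Finsupp.sum_add, ← hq] at h
      have e1 : (c.sum fun i ci => ci * K i v * l) = b * l := by
        rw [← hb', Finsupp.sum_mul]
      have e2 : (c.sum fun j cj => l * K v j * cj) = l * b := by
        rw [hb, Finsupp.mul_sum]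
        exact Finsupp.sum_congr fun i _ => by ring
      rw [e1, e2] at h
      nlinarith [h]
    have goal_eq : (c.sum fun i ci => c.sum fun j cj => star ci *
        (Matrix.of fun i j => K i j - K i v * K v j / (s + K v v)) i j * cj)
        = q - b ^ 2 / (s + K v v) := by
      have : b ^ 2 / (s + K v v)
          = c.sum fun i ci => c.sum fun j cj => (ci * K i v) * (K v j * cj) / (s + K v v) := by
        simp only [Finsupp.sum, ← Finset.sum_div, ← Finset.sum_mul_sum]
        rw [sq]
        congr 2
        exact hb'.symm
      rw [this, hq, ← Finsupp.sum_sub]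
      refine Finsupp.sum_congr fun i _ => ?_
      rw [← Finsupp.sum_sub]
      refine Finsupp.sum_congr fun j _ => ?_
      simp only [star_trivial, Matrix.of_apply]
      ring
    rw [goal_eq]
    -- This `l` minimises `q + 2 l b + l² (s + K v v)`, whose minimum is the form to be bounded;
    -- `expand` lacks only the nonnegative term `s l²`.
    have h := expand (-b / (s + K v v))
    have h2 : q + 2 * (-b / (s + K v v)) * b + (-b / (s + K v v)) ^ 2 * K v v
        = q - b ^ 2 / (s + K v v) - s * (b / (s + K v v)) ^ 2 := by
      field_simp
      ring
    rw [h2] at h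
    nlinarith [mul_nonneg hs.le (sq_nonneg (b / (s + K v v)))]

/-! ### The recursion as successive conditioning of a kernel -/

namespace RecursiveGP

variable {S : Type*}

theorem appendEntry_dotProduct {t : ℕ} (v w : Fin t → ℝ) (a b : ℝ) :
    appendEntry v a ⬝ᵥ appendEntry w b = v ⬝ᵥ w + a * b := by
  simp [appendEntry, dotProduct, Fin.sum_univ_castSucc]

theorem padMatrix_mulVec {t : ℕ} (M : Matrix (Fin t) (Fin t) ℝ) (w : Fin t → ℝ) (b : ℝ) :
    padMatrix M *ᵥ appendEntry w b = appendEntry (M *ᵥ w) 0 := by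
  ext i
  refine Fin.lastCases ?_ (fun j => ?_) i
  · simp [padMatrix, appendEntry, mulVec, dotProduct]
  · simp [padMatrix, appendEntry, mulVec, dotProduct, Fin.sum_univ_castSucc]

theorem gramVec_succ (κ : S → S → ℝ) (x : ℕ → S) (t : ℕ) (z : S) :
    gramVec κ x (t + 1) z = appendEntry (gramVec κ x t z) (κ (x (t + 1)) z) := by
  ext i
  refine Fin.lastCases ?_ (fun j => ?_) i <;> simp [gramVec, appendEntry]

/-- Predictive covariance `κ(z, w) + K(z, X_t) C_t K(X_t, w)`. -/
noncomputable def covariance (κ : S → S → ℝ) (σe : ℝ) (x : ℕ → S) (y : ℕ → ℝ) (t : ℕ) (z w : S) : ℝ :=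
  κ z w + gramVec κ x t z ⬝ᵥ ((state κ σe x y t).2 *ᵥ gramVec κ x t w)

theorem covariance_self (κ : S → S → ℝ) (σe : ℝ) (x : ℕ → S) (y : ℕ → ℝ) (t : ℕ) (z : S) :
    covariance κ σe x y t z z = variance κ σe x y t z := rfl

theorem state_snd_transpose (κ : S → S → ℝ) (σe : ℝ) (x : ℕ → S) (y : ℕ → ℝ) (t : ℕ) :
    (state κ σe x y t).2ᵀ = (state κ σe x y t).2 := by
  induction t with
  | zero => ext i; exact i.elim0
  | succ t ih =>
    have hpad : (padMatrix (state κ σe x y t).2)ᵀ = padMatrix (state κ σe x y t).2 := by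
      ext i j
      refine Fin.lastCases ?_ (fun i => ?_) i <;> refine Fin.lastCases ?_ (fun j => ?_) j <;>
        simp [padMatrix, appendEntry]
      simpa using congrFun (congrFun ih i) j
    simp only [state, Matrix.transpose_add, Matrix.transpose_smul, hpad,
      Matrix.transpose_vecMulVec]

theorem mean_zero (κ : S → S → ℝ) (σe : ℝ) (x : ℕ → S) (y : ℕ → ℝ) (z : S) :
    mean κ σe x y 0 z = 0 := by
  simp [mean, state]

theorem variance_zero (κ : S → S → ℝ) (σe : ℝ) (x : ℕ → S) (y : ℕ → ℝ) (z : S) :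
    variance κ σe x y 0 z = κ z z := by
  simp [variance, state]

/-- Pairing `s = [C k ; 1]` with the kernel vector of `z` gives the current covariance of `z` and
the new input, and `d` is `σe²` plus the current variance there. The rank-one update is thus a Schur
complement. -/
theorem covariance_succ {κ : S → S → ℝ} (hsymm : ∀ z w, κ z w = κ w z) (σe : ℝ) (x : ℕ → S)
    (y : ℕ → ℝ) (t : ℕ) (z w : S) :
    covariance κ σe x y (t + 1) z w = covariance κ σe x y t z w
      - covariance κ σe x y t z (x (t + 1)) * covariance κ σe x y t (x (t + 1)) w
        / (σe ^ 2 + covariance κ σe x y t (x (t + 1)) (x (t + 1))) := by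
  have hswap : (state κ σe x y t).2 *ᵥ gramVec κ x t (x (t + 1)) ⬝ᵥ gramVec κ x t w
      = gramVec κ x t (x (t + 1)) ⬝ᵥ (state κ σe x y t).2 *ᵥ gramVec κ x t w := by
    rw [dotProduct_mulVec, ← mulVec_transpose, state_snd_transpose]
  simp only [covariance, state, gramVec_succ, Matrix.add_mulVec, padMatrix_mulVec,
    Matrix.smul_mulVec, Matrix.vecMulVec_mulVec, dotProduct_add, dotProduct_smul,
    appendEntry_dotProduct, hswap, hsymm z (x (t + 1)), smul_eq_mul,
    op_smul_eq_smul]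
  ring

theorem mean_succ {κ : S → S → ℝ} (hsymm : ∀ z w, κ z w = κ w z) (σe : ℝ) (x : ℕ → S)
    (y : ℕ → ℝ) (t : ℕ) (z : S) :
    mean κ σe x y (t + 1) z = mean κ σe x y t z
      + (y (t + 1) - mean κ σe x y t (x (t + 1)))
        / (σe ^ 2 + covariance κ σe x y t (x (t + 1)) (x (t + 1)))
        * covariance κ σe x y t z (x (t + 1)) := by
  simp only [mean, covariance, state, gramVec_succ, dotProduct_add, dotProduct_smul,
    appendEntry_dotProduct, hsymm z (x (t + 1)), smul_eq_mul]
  ring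

/-! ### Monotone variances and vanishing mean increments -/

section Convergence

variable {κ : S → S → ℝ} (hκ : (Matrix.of κ).PosSemidef) {σe : ℝ} (hσe : 0 < σe)
  (x : ℕ → S) (y : ℕ → ℝ)
include hκ

theorem kernel_symm (z w : S) : κ z w = κ w z := by
  simpa using hκ.1.apply w z

include hσe

theorem covariance_posSemidef (t : ℕ) :
    (Matrix.of (covariance κ σe x y t)).PosSemidef := by
  induction t with
  | zero =>
    convert hκ using 2
    ext z w
    simp [covariance, state]
  | succ t ih =>
    convert ih.condition (x (t + 1)) (pow_pos hσe 2) using 2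
    ext z w
    exact covariance_succ (kernel_symm hκ) σe x y t z w

theorem variance_nonneg (t : ℕ) (z : S) : 0 ≤ variance κ σe x y t z :=
  (covariance_posSemidef hκ hσe x y t).diag_nonneg (i := z)

theorem variance_succ (t : ℕ) (z : S) :
    variance κ σe x y (t + 1) z = variance κ σe x y t z
      - covariance κ σe x y t z (x (t + 1)) ^ 2
        / (σe ^ 2 + variance κ σe x y t (x (t + 1))) := by
  have h : covariance κ σe x y t (x (t + 1)) z = covariance κ σe x y t z (x (t + 1)) := by
    simpa using (covariance_posSemidef hκ hσe x y t).1.apply z (x (t + 1))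
  rw [← covariance_self, covariance_succ (kernel_symm hκ), h, sq (covariance κ σe x y t z _)]
  rfl

theorem variance_antitone (z : S) : Antitone fun t => variance κ σe x y t z := by
  refine antitone_nat_of_succ_le fun t => ?_
  have := variance_nonneg hκ hσe x y t (x (t + 1))
  rw [variance_succ hκ hσe]
  have : 0 ≤ covariance κ σe x y t z (x (t + 1)) ^ 2
        / (σe ^ 2 + variance κ σe x y t (x (t + 1))) := by positivity
  linarith

theorem variance_le (t : ℕ) (z : S) : variance κ σe x y t z ≤ κ z z := by
  simpa [variance_zero] using variance_antitone hκ hσe x y z (Nat.zero_le t)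

theorem exists_tendsto_variance (z : S) :
    ∃ l, 0 ≤ l ∧ Tendsto (fun t => variance κ σe x y t z) atTop (𝓝 l) := by
  have hb : BddBelow (Set.range fun t => variance κ σe x y t z) :=
    ⟨0, by rintro _ ⟨t, rfl⟩; exact variance_nonneg hκ hσe x y t z⟩
  exact ⟨_, le_ciInf fun t => variance_nonneg hκ hσe x y t z,
    tendsto_atTop_ciInf (variance_antitone hκ hσe x y z) hb⟩

/-- The consecutive differences of a convergent variance sequence vanish, and each equals the
squared covariance divided by at most `σe ^ 2 + c`. No assumption on how the inputs are distributed
enters. -/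
theorem tendsto_covariance_input {c : ℝ} (hc : ∀ z, κ z z ≤ c) (z : S) :
    Tendsto (fun t => covariance κ σe x y t z (x (t + 1))) atTop (𝓝 0) := by
  obtain ⟨l, -, hl⟩ := exists_tendsto_variance hκ hσe x y z
  have hdiff : Tendsto (fun t => (variance κ σe x y t z - variance κ σe x y (t + 1) z)
      * (σe ^ 2 + c)) atTop (𝓝 0) := by
    simpa using (hl.sub (hl.comp (tendsto_add_atTop_nat 1))).mul_const (σe ^ 2 + c)
  have hsq : Tendsto (fun t => covariance κ σe x y t z (x (t + 1)) ^ 2) atTop (𝓝 0) := by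
    refine squeeze_zero (fun t => sq_nonneg _) (fun t => ?_) hdiff
    have h0 := variance_nonneg hκ hσe x y t (x (t + 1))
    have h1 := (variance_le hκ hσe x y t (x (t + 1))).trans (hc _)
    have hd : 0 < σe ^ 2 + variance κ σe x y t (x (t + 1)) := by positivity
    rw [variance_succ hκ hσe, sub_sub_cancel]
    calc covariance κ σe x y t z (x (t + 1)) ^ 2
        = covariance κ σe x y t z (x (t + 1)) ^ 2
          / (σe ^ 2 + variance κ σe x y t (x (t + 1)))
          * (σe ^ 2 + variance κ σe x y t (x (t + 1))) := by field_simp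
      _ ≤ _ := by gcongr
  have := hsq.sqrt
  simp only [Real.sqrt_sq_eq_abs, Real.sqrt_zero] at this
  exact (tendsto_zero_iff_abs_tendsto_zero _).2 this

/-- The innovation is at most `ybar + mubar` and the denominator at least `σe ^ 2`, so the increment
is dominated by a constant times the vanishing covariance. -/
theorem tendsto_mean_succ_sub {c : ℝ} (hc : ∀ z, κ z z ≤ c) {ybar mubar : ℝ}
    (hy : ∀ t, 1 ≤ t → |y t| ≤ ybar) (hmu : ∀ t, 1 ≤ t → ∀ z, |mean κ σe x y t z| ≤ mubar)
    (z : S) :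
    Tendsto (fun t => mean κ σe x y (t + 1) z - mean κ σe x y t z) atTop (𝓝 0) := by
  have hcov := ((tendsto_covariance_input hκ hσe x y hc z).abs).const_mul
    ((ybar + mubar) / σe ^ 2)
  rw [abs_zero, mul_zero] at hcov
  refine squeeze_zero_norm' ?_ hcov
  filter_upwards [eventually_ge_atTop 1] with t ht
  have h0 := variance_nonneg hκ hσe x y t (x (t + 1))
  rw [mean_succ (kernel_symm hκ), add_sub_cancel_left, Real.norm_eq_abs, abs_mul, abs_div,
    covariance_self, abs_of_pos (by positivity : 0 < σe ^ 2 + variance κ σe x y t (x (t + 1)))]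
  have h1 := hy (t + 1) (by omega)
  have h2 := hmu t ht (x (t + 1))
  have h3 := abs_sub (y (t + 1)) (mean κ σe x y t (x (t + 1)))
  have h4 : 0 ≤ ybar + mubar := by linarith [abs_nonneg (y (t + 1)), (abs_nonneg _).trans h2]
  gcongr
  · linarith
  · linarith

end Convergence

end RecursiveGP

/-! ### Contraction estimates -/

/-- A sequence that contracts over `T` steps up to a vanishing perturbation tends to zero. -/
theorem tendsto_zero_of_delayed_contraction {a ε : ℕ → ℝ} (ha : ∀ t, 0 ≤ a t) {T : ℕ} (hT : 0 < T)
    {ρ : ℝ} (hρ₀ : 0 ≤ ρ) (hρ₁ : ρ < 1) (hε : Tendsto ε atTop (𝓝 0))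
    (hstep : ∀ t, 1 ≤ t → a (t + T) ≤ ρ * a t + ε t) :
    Tendsto a atTop (𝓝 0) := by
  rw [Metric.tendsto_atTop]
  intro δ hδ
  -- The threshold makes `δ / 2` the fixed point of `a ↦ ρ a + δ / 2 * (1 - ρ)`.
  have hev : ∀ᶠ t in atTop, 1 ≤ t ∧ ε t ≤ δ / 2 * (1 - ρ) := by
    have : (0 : ℝ) < δ / 2 * (1 - ρ) := by nlinarith
    exact (eventually_ge_atTop 1).and (hε.eventually_le_const this)
  obtain ⟨N, hN⟩ := eventually_atTop.1 hev
  -- `M` dominates all `T` starting values, so one bound serves every residue class modulo `T`.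
  set M : ℝ := ∑ r ∈ Finset.range T, a (N + r) with hM
  have hM0 : 0 ≤ M := Finset.sum_nonneg fun r _ => ha _
  have iter : ∀ r, r < T → ∀ k, a (N + r + k * T) ≤ ρ ^ k * M + δ / 2 := by
    intro r hr k
    induction k with
    | zero =>
      have : a (N + r) ≤ M :=
        Finset.single_le_sum (f := fun r => a (N + r)) (fun r _ => ha _) (Finset.mem_range.2 hr)
      simp only [zero_mul, add_zero, pow_zero, one_mul]
      linarith
    | succ k ih =>
      have h := hstep (N + r + k * T) ((hN _ (by omega)).1)
      have h2 := (hN (N + r + k * T) (by omega)).2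
      have e : N + r + (k + 1) * T = N + r + k * T + T := by ring
      rw [e, pow_succ']
      nlinarith [mul_le_mul_of_nonneg_left ih hρ₀]
  have hpow : Tendsto (fun k : ℕ => ρ ^ k * M) atTop (𝓝 0) := by
    simpa using (tendsto_pow_atTop_nhds_zero_of_lt_one hρ₀ hρ₁).mul_const M
  obtain ⟨K, hK⟩ := eventually_atTop.1 (hpow.eventually_lt_const (half_pos hδ))
  refine ⟨N + K * T, fun t ht => ?_⟩
  rw [Real.dist_eq, sub_zero, abs_of_nonneg (ha t)]
  have hdiv : N + (t - N) % T + (t - N) / T * T = t := by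
    have := Nat.mod_add_div (t - N) T
    rw [mul_comm T] at this
    omega
  have hk : K ≤ (t - N) / T := (Nat.le_div_iff_mul_le hT).2 (by omega)
  have h := iter _ (Nat.mod_lt (t - N) hT) ((t - N) / T)
  rw [hdiv] at h
  linarith [hK _ hk]

section Stochastic

variable {ι : Type*} [Fintype ι]

theorem norm_mulVec_le_of_row_stochastic {M : Matrix ι ι ℝ} (h0 : ∀ i j, 0 ≤ M i j)
    (h1 : M *ᵥ (1 : ι → ℝ) = 1) (v : ι → ℝ) : ‖M *ᵥ v‖ ≤ ‖v‖ := by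
  refine (pi_norm_le_iff_of_nonneg (norm_nonneg v)).2 fun i => ?_
  have hrow : ∑ j, M i j = 1 := by simpa [mulVec, dotProduct] using congrFun h1 i
  calc ‖(M *ᵥ v) i‖ ≤ ∑ j, ‖M i j * v j‖ := norm_sum_le _ _
    _ ≤ ∑ j, M i j * ‖v‖ := by
      refine Finset.sum_le_sum fun j _ => ?_
      rw [norm_mul, Real.norm_of_nonneg (h0 i j)]
      exact mul_le_mul_of_nonneg_left (norm_le_pi_norm v j) (h0 i j)
    _ = ‖v‖ := by rw [← Finset.sum_mul, hrow, one_mul]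

/-- A row stochastic matrix with entries at least `c` contracts the zero-sum vectors by the factor
`1 - c * card ι`. -/
theorem norm_mulVec_le_of_zero_sum {M : Matrix ι ι ℝ} {c : ℝ} (hc : ∀ i j, c ≤ M i j)
    (h1 : M *ᵥ (1 : ι → ℝ) = 1) {v : ι → ℝ} (hv : ∑ i, v i = 0) (hι : Nonempty ι) :
    ‖M *ᵥ v‖ ≤ (1 - c * Fintype.card ι) * ‖v‖ := by
  refine (pi_norm_le_iff_of_nonempty _).2 fun i => ?_
  have hrow : ∑ j, M i j = 1 := by simpa [mulVec, dotProduct] using congrFun h1 i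
  -- Subtracting the constant `c` from all entries does not change the product with a zero-sum
  -- vector; the entries stay nonnegative and the row sum drops to `1 - c * card ι`.
  have hshift : (M *ᵥ v) i = ∑ j, (M i j - c) * v j := by
    simp only [sub_mul, Finset.sum_sub_distrib, ← Finset.mul_sum, hv, mul_zero, sub_zero]
    rfl
  rw [hshift]
  calc ‖∑ j, (M i j - c) * v j‖ ≤ ∑ j, ‖(M i j - c) * v j‖ := norm_sum_le _ _
    _ ≤ ∑ j, (M i j - c) * ‖v‖ := by
      refine Finset.sum_le_sum fun j _ => ?_
      have := sub_nonneg.2 (hc i j)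
      rw [norm_mul, Real.norm_of_nonneg this]
      exact mul_le_mul_of_nonneg_left (norm_le_pi_norm v j) this
    _ = _ := by
      rw [← Finset.sum_mul, Finset.sum_sub_distrib, hrow]
      simp [mul_comm]

end Stochastic

/-! ### Products of weight matrices over a periodically connected network -/

namespace Network

variable {p : ℕ}

/-- The product `A (s + k - 1) * … * A s`. -/
noncomputable def transition (A : ℕ → Matrix (Fin p) (Fin p) ℝ) (s : ℕ) : ℕ → Matrix (Fin p) (Fin p) ℝ
  | 0 => 1
  | k + 1 => A (s + k) * transition A s k

theorem entry_eq_zero_or_le {G : ℕ → Digraph (Fin p)} {A : ℕ → Matrix (Fin p) (Fin p) ℝ} {φ : ℝ}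
    (hA : ∀ t, IsWeightedAdjacency (G t) (A t)) (hnondeg : NonDegenerate G A φ)
    {t : ℕ} (ht : 1 ≤ t) (i j : Fin p) : A t i j = 0 ∨ φ ≤ A t i j := by
  obtain ⟨-, hd, hn⟩ := hnondeg t ht i
  by_cases hij : i = j
  · exact .inr (hij ▸ hd)
  by_cases hG : (G t).Adj i j
  · refine (hn j ?_).imp_right fun h => h.1
    simp [neighbors, hG, Ne.symm hij]
  · exact .inl (not_not.1 (mt ((hA t i j hij).2) hG))

theorem transition_mulVec_one {A : ℕ → Matrix (Fin p) (Fin p) ℝ} (hstoch : DoublyStochastic A)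
    {s : ℕ} (hs : 1 ≤ s) (k : ℕ) : transition A s k *ᵥ (1 : Fin p → ℝ) = 1 := by
  induction k with
  | zero => simp [transition]
  | succ k ih => rw [transition, ← mulVec_mulVec, ih, (hstoch (s + k) (by omega)).2]

section Positivity

variable {G : ℕ → Digraph (Fin p)} {A : ℕ → Matrix (Fin p) (Fin p) ℝ} {φ : ℝ}
  (hA : ∀ t, IsWeightedAdjacency (G t) (A t)) (hφ : 0 < φ) (hnondeg : NonDegenerate G A φ)
include hA hφ hnondeg

theorem entry_nonneg {t : ℕ} (ht : 1 ≤ t) (i j : Fin p) : 0 ≤ A t i j := by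
  rcases entry_eq_zero_or_le hA hnondeg ht i j with h | h
  · exact h.ge
  · exact hφ.le.trans h

theorem transition_nonneg {s : ℕ} (hs : 1 ≤ s) (k : ℕ) (i j : Fin p) :
    0 ≤ transition A s k i j := by
  induction k generalizing i with
  | zero =>
    rw [transition, Matrix.one_apply]
    split_ifs <;> norm_num
  | succ k ih =>
    rw [transition, Matrix.mul_apply]
    exact Finset.sum_nonneg fun l _ =>
      mul_nonneg (entry_nonneg hA hφ hnondeg (by omega) i l) (ih l)

theorem pow_le_transition_succ {s : ℕ} (hs : 1 ≤ s) {k : ℕ} {i l j : Fin p}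
    (hil : φ ≤ A (s + k) i l) (h : φ ^ k ≤ transition A s k l j) :
    φ ^ (k + 1) ≤ transition A s (k + 1) i j := by
  rw [transition, Matrix.mul_apply]
  calc φ ^ (k + 1) = φ * φ ^ k := pow_succ' φ k
    _ ≤ A (s + k) i l * transition A s k l j := by gcongr; exact hφ.le.trans hil
    _ ≤ _ := Finset.single_le_sum (f := fun l => A (s + k) i l * transition A s k l j)
        (fun l _ => mul_nonneg (entry_nonneg hA hφ hnondeg (by omega) i l)
          (transition_nonneg hA hφ hnondeg hs k l j)) (Finset.mem_univ l)

/-- The diagonal weights are at least `φ`, so a node can keep its weight at the cost of one factor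
`φ` per step. -/
theorem pow_le_transition_mono {s : ℕ} (hs : 1 ≤ s) {k m : ℕ} (hkm : k ≤ m) {i j : Fin p}
    (h : φ ^ k ≤ transition A s k i j) : φ ^ m ≤ transition A s m i j := by
  induction m, hkm using Nat.le_induction with
  | base => exact h
  | succ m _ ih =>
    exact pow_le_transition_succ hA hφ hnondeg hs (hnondeg (s + m) (by omega) i).2.1 ih

/-- Over `p * B` consecutive steps every pair of nodes gets a transition weight bounded below. -/
theorem pow_le_transition {B : ℕ} (hconn : PeriodicallyStronglyConnected G B) {s : ℕ}
    (hs : 1 ≤ s) (i j : Fin p) : φ ^ (p * B) ≤ transition A s (p * B) i j := by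
  classical
  -- `R k` collects the nodes that `j` has influenced with weight at least `φ ^ k` after `k` steps;
  -- it increases with `k`.
  let R : ℕ → Finset (Fin p) := fun k => {i | φ ^ k ≤ transition A s k i j}
  have mem_R : ∀ k i, i ∈ R k ↔ φ ^ k ≤ transition A s k i j := by simp [R]
  have mono : ∀ {k m}, k ≤ m → R k ⊆ R m := fun hkm i hi => by
    rw [mem_R] at hi ⊢
    exact pow_le_transition_mono hA hφ hnondeg hs hkm hi
  have hj : ∀ k, j ∈ R k := fun k => mono (Nat.zero_le k) (by simp [mem_R, transition])
  -- If `R` stalled over a window of `B` steps, any node with an edge of the union graph into `R k`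
  -- would lie in `R (k + B) = R k`. Going back along paths that end at `j`, strong connectivity
  -- would make `R k` everything.
  have grow : ∀ k, R k ≠ Finset.univ → R k ⊂ R (k + B) := by
    intro k hk
    refine (mono (Nat.le_add_right k B)).ssubset_of_ne fun heq => hk ?_
    refine Finset.eq_univ_iff_forall.2 fun a => ?_
    refine Relation.ReflTransGen.head_induction_on (hconn (s + k) (by omega) a j) (hj k) ?_
    rintro a b ⟨r, hr, hab⟩ - hb
    by_cases hne : a = b
    · rwa [hne]
    rw [heq]
    refine mono (show k + r + 1 ≤ k + B by omega) ((mem_R _ _).2 ?_)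
    rw [add_assoc] at hab
    refine pow_le_transition_succ hA hφ hnondeg hs ?_
      ((mem_R _ _).1 (mono (Nat.le_add_right k r) hb))
    exact (entry_eq_zero_or_le hA hnondeg (by omega) a b).resolve_left ((hA _ a b hne).1 hab)
  have card : ∀ m, R (m * B) = Finset.univ ∨ m + 1 ≤ (R (m * B)).card := by
    intro m
    induction m with
    | zero => exact .inr (Finset.card_pos.2 ⟨j, hj _⟩)
    | succ m ih =>
      have e : (m + 1) * B = m * B + B := by ring
      rw [e]
      by_cases hu : R (m * B) = Finset.univ
      · exact .inl (Finset.univ_subset_iff.1 (hu ▸ mono (Nat.le_add_right _ _)))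
      · have := Finset.card_lt_card (grow _ hu)
        have := ih.resolve_left hu
        exact .inr (by omega)
  -- The alternative would be a set of more than `p` nodes.
  have hu : R (p * B) = Finset.univ := by
    refine (card p).resolve_right fun h => ?_
    have := Finset.card_le_univ (R (p * B))
    simp at this
    omega
  exact (mem_R _ _).1 (hu ▸ Finset.mem_univ i)

/-- Row stochastic matrices do not expand the sup norm, so the perturbations of the individual steps
at most add up. -/
theorem norm_sub_transition_le (hstoch : DoublyStochastic A) {e w : ℕ → Fin p → ℝ}
    (he : ∀ t, 1 ≤ t → e (t + 1) = A t *ᵥ e t + w t) {s : ℕ} (hs : 1 ≤ s) (k : ℕ) :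
    ‖e (s + k) - transition A s k *ᵥ e s‖ ≤ ∑ r ∈ Finset.range k, ‖w (s + r)‖ := by
  induction k with
  | zero => simp [transition]
  | succ k ih =>
    have hsplit : e (s + (k + 1)) - transition A s (k + 1) *ᵥ e s
        = A (s + k) *ᵥ (e (s + k) - transition A s k *ᵥ e s) + w (s + k) := by
      rw [← add_assoc, he (s + k) (by omega), transition, ← mulVec_mulVec, mulVec_sub]
      abel
    rw [hsplit, Finset.sum_range_succ]
    refine (norm_add_le _ _).trans (add_le_add_left ?_ _)
    exact (norm_mulVec_le_of_row_stochastic (entry_nonneg hA hφ hnondeg (by omega))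
      (hstoch (s + k) (by omega)).2 _).trans ih

/-- Perturbed averaging of zero-sum vectors dies out when the perturbation does. -/
theorem tendsto_zero_of_perturbed_averaging (hp : 1 ≤ p) {B : ℕ} (hB : 1 ≤ B)
    (hconn : PeriodicallyStronglyConnected G B) (hstoch : DoublyStochastic A)
    {e w : ℕ → Fin p → ℝ} (he : ∀ t, 1 ≤ t → e (t + 1) = A t *ᵥ e t + w t)
    (hsum : ∀ t, 1 ≤ t → ∑ i, e t i = 0) (hw : Tendsto w atTop (𝓝 0)) :
    Tendsto e atTop (𝓝 0) := by
  have : Nonempty (Fin p) := ⟨⟨0, hp⟩⟩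
  rw [tendsto_zero_iff_norm_tendsto_zero]
  have hε : Tendsto (fun t => ∑ r ∈ Finset.range (p * B), ‖w (t + r)‖) atTop (𝓝 0) := by
    rw [← Finset.sum_const_zero (s := Finset.range (p * B))]
    refine tendsto_finsetSum _ fun r _ => ?_
    simpa using (hw.comp (tendsto_add_atTop_nat r)).norm
  have hc := fun s (hs : 1 ≤ s) => pow_le_transition hA hφ hnondeg hconn hs
  refine tendsto_zero_of_delayed_contraction (T := p * B) (ρ := 1 - φ ^ (p * B) * p)
    (fun t => norm_nonneg _) (Nat.mul_pos hp hB) ?_ ?_ hε fun t ht => ?_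
  -- The contraction factor is nonnegative because `p` entries, each at least `φ ^ (p * B)`, add up
  -- to a row sum of 1.
  · have hrow : ∑ j, transition A 1 (p * B) ⟨0, hp⟩ j = 1 := by
      simpa [mulVec, dotProduct] using
        congrFun (transition_mulVec_one hstoch le_rfl (p * B)) ⟨0, hp⟩
    have := Finset.sum_le_sum fun j (_ : j ∈ Finset.univ) => hc 1 le_rfl ⟨0, hp⟩ j
    rw [hrow] at this
    simp only [Finset.sum_const, Finset.card_univ, Fintype.card_fin, nsmul_eq_mul] at this
    linarith
  · have : (0 : ℝ) < p := by exact_mod_cast hp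
    have : 0 < φ ^ (p * B) * p := by positivity
    linarith
  · have h1 := norm_mulVec_le_of_zero_sum (hc t ht) (transition_mulVec_one hstoch ht _)
      (hsum t ht) this
    have h2 := norm_sub_transition_le hA hφ hnondeg hstoch he ht (p * B)
    have h3 := norm_le_norm_sub_add (e (t + p * B)) (transition A t (p * B) *ᵥ e t)
    rw [Fintype.card_fin] at h1
    linarith

end Positivity

end Network

/-- If `u - q * V → 0`, `v - V → 0`, `V` tends to a nonzero limit and `q` is bounded, then
`u / v - q → 0`. -/
theorem tendsto_quotient_sub_zero {u v V q : ℕ → ℝ} {l c : ℝ} (hl : l ≠ 0)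
    (hV : Tendsto V atTop (𝓝 l)) (hv : Tendsto (fun t => v t - V t) atTop (𝓝 0))
    (hu : Tendsto (fun t => u t - q t * V t) atTop (𝓝 0)) (hq : ∀ᶠ t in atTop, |q t| ≤ c) :
    Tendsto (fun t => u t * (v t)⁻¹ - q t) atTop (𝓝 0) := by
  have hvl : Tendsto v atTop (𝓝 l) := by simpa using hv.add hV
  have hqv : Tendsto (fun t => q t * (v t - V t)) atTop (𝓝 0) := by
    have hbound := hv.abs.const_mul c
    rw [abs_zero, mul_zero] at hbound
    refine squeeze_zero_norm' ?_ hbound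
    filter_upwards [hq] with t ht
    rw [Real.norm_eq_abs, abs_mul]
    gcongr
  -- Uses `u / v - q = ((u - q V) - q (v - V)) / v`; boundedness of `q` suffices, convergence is not
  -- needed.
  have hprod := (hu.sub hqv).mul (hvl.inv₀ hl)
  rw [sub_zero, zero_mul] at hprod
  refine hprod.congr' ?_
  filter_upwards [hvl.eventually_ne hl] with t ht
  field_simp
  ring

/-! ### Dynamic average consensus -/

namespace Aggregation

variable {p : ℕ}

theorem consensus_succ_apply {G : ℕ → Digraph (Fin p)} {A : ℕ → Matrix (Fin p) (Fin p) ℝ}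
    (hA : ∀ t, Network.IsWeightedAdjacency (G t) (A t)) (hstoch : Network.DoublyStochastic A)
    (r : ℕ → Fin p → Fin 2 → ℝ) {t : ℕ} (ht : 1 ≤ t) (i : Fin p) (c : Fin 2) :
    consensus G A r (t + 1) i c
      = (A t *ᵥ fun j => consensus G A r t j c) i + increment r t i c := by
  have hrow : ∑ j, A t i j = 1 := by
    simpa [mulVec, dotProduct] using congrFun (hstoch t ht).2 i
  have hsum : ∑ j ∈ Network.neighbors (G t) i,
        A t i j * (consensus G A r t j c - consensus G A r t i c)
      = ∑ j, A t i j * (consensus G A r t j c - consensus G A r t i c) := by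
    refine Finset.sum_subset (Finset.subset_univ _) fun j _ hj => ?_
    by_cases hij : i = j
    · simp [hij]
    · have : A t i j = 0 := by
        by_contra h
        exact hj (by simp [Network.neighbors, (hA t i j hij).2 h, Ne.symm hij])
      simp [this]
  simp only [consensus, Pi.add_apply, Finset.sum_apply, Pi.smul_apply, Pi.sub_apply, smul_eq_mul,
    hsum]
  simp only [mul_sub, Finset.sum_sub_distrib, ← Finset.sum_mul, hrow, mulVec, dotProduct]
  ring

/-- From time `1` on the consensus variables carry the total of the reference signal, provided that
all agents start from the same value. -/
theorem sum_consensus_succ {G : ℕ → Digraph (Fin p)} {A : ℕ → Matrix (Fin p) (Fin p) ℝ}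
    (hA : ∀ t, Network.IsWeightedAdjacency (G t) (A t)) (hstoch : Network.DoublyStochastic A)
    {r : ℕ → Fin p → Fin 2 → ℝ} (hr : ∀ i j, r 0 i = r 0 j) (c : Fin 2) (t : ℕ) :
    ∑ i, consensus G A r (t + 1) i c = ∑ i, r t i c := by
  induction t with
  | zero =>
    -- The weights at time 0 are not assumed stochastic, but they only multiply differences of equal
    -- initial values.
    refine Finset.sum_congr rfl fun i _ => ?_
    simp [consensus, increment, fun j => hr j i]
  | succ t ih =>
    have hcol : ∑ i, (A (t + 1) *ᵥ fun j => consensus G A r (t + 1) j c) i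
        = ∑ j, consensus G A r (t + 1) j c := by
      have := dotProduct_mulVec (1 : Fin p → ℝ) (A (t + 1))
        fun j => consensus G A r (t + 1) j c
      rw [(hstoch (t + 1) (by omega)).1] at this
      simpa [dotProduct] using this
    simp only [consensus_succ_apply hA hstoch r (Nat.le_add_left 1 t), Finset.sum_add_distrib,
      hcol, ih, increment, Pi.sub_apply, Finset.sum_sub_distrib]
    ring

/-- Dynamic average consensus tracks the average of a reference signal with vanishing increments. -/
theorem tendsto_consensus_sub_average (hp : 1 ≤ p) {G : ℕ → Digraph (Fin p)}
    {A : ℕ → Matrix (Fin p) (Fin p) ℝ} (hA : ∀ t, Network.IsWeightedAdjacency (G t) (A t))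
    {B : ℕ} (hB : 1 ≤ B) (hconn : Network.PeriodicallyStronglyConnected G B)
    {φ : ℝ} (hφ : 0 < φ) (hnondeg : Network.NonDegenerate G A φ)
    (hstoch : Network.DoublyStochastic A) {r : ℕ → Fin p → Fin 2 → ℝ}
    (hr : ∀ i j, r 0 i = r 0 j) (c : Fin 2)
    (hinc : ∀ i, Tendsto (fun t => increment r t i c) atTop (𝓝 0)) (i : Fin p) :
    Tendsto (fun t => consensus G A r (t + 1) i c - (∑ j, r t j c) / p) atTop (𝓝 0) := by
  have hp0 : (p : ℝ) ≠ 0 := by positivity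
  set avg : (Fin p → ℝ) → ℝ := fun v => (∑ j, v j) / p with havg
  have sum_sub : ∀ v : Fin p → ℝ, ∑ i, (v i - avg v) = 0 := by
    intro v
    simp only [Finset.sum_sub_distrib, Finset.sum_const, Finset.card_univ, Fintype.card_fin,
      nsmul_eq_mul, havg]
    field_simp
    ring
  set ξ : ℕ → Fin p → ℝ := fun t j => consensus G A r t j c with hξ
  -- `A t` fixes constant vectors, so the deviations from the average obey the same recursion,
  -- driven by the centred increments.
  have hstep : ∀ t, 1 ≤ t → (fun j => ξ (t + 1) j - avg (ξ (t + 1)))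
      = A t *ᵥ (fun j => ξ t j - avg (ξ t))
        + fun j => increment r t j c - avg fun k => increment r t k c := by
    intro t ht
    have hvec : (fun j => ξ t j - avg (ξ t)) = ξ t - avg (ξ t) • (1 : Fin p → ℝ) := by
      ext; simp
    have havg_step : avg (ξ (t + 1)) = avg (ξ t) + avg fun k => increment r t k c := by
      -- The total of `ξ` lags one step behind that of `r`, so `t` is written as a successor to
      -- express both averages through `r`.
      obtain ⟨t, rfl⟩ := Nat.exists_eq_add_of_le' ht
      simp only [havg, hξ, sum_consensus_succ hA hstoch hr, increment, Pi.sub_apply,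
        Finset.sum_sub_distrib]
      ring
    rw [hvec, mulVec_sub, mulVec_smul, (hstoch t ht).2]
    ext j
    have := consensus_succ_apply hA hstoch r ht j c
    simp only [Pi.add_apply, Pi.sub_apply, Pi.smul_apply, Pi.one_apply, smul_eq_mul, mul_one,
      havg_step]
    simp only [hξ, this]
    ring
  have hw : Tendsto (fun t j => increment r t j c - avg fun k => increment r t k c)
      atTop (𝓝 0) := by
    refine tendsto_pi_nhds.2 fun j => ?_
    have hs := (tendsto_finsetSum Finset.univ fun k _ => hinc k).div_const (p : ℝ)
    simpa using (hinc j).sub hs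
  have hlim := Network.tendsto_zero_of_perturbed_averaging hA hφ hnondeg hp hB hconn hstoch
    hstep (fun t _ => sum_sub _) hw
  have := ((tendsto_pi_nhds.1 hlim i).comp (tendsto_add_atTop_nat 1))
  refine this.congr fun t => ?_
  simp only [Function.comp_apply, havg, hξ, sum_consensus_succ hA hstoch hr]

/-! ### The Gaussian process reference signal and the quotient of consensus states -/

section Reference

variable {S : Type*} {κ : S → S → ℝ} (hκ : (Matrix.of κ).PosSemidef) {σe σn : ℝ}
  (hσe : 0 < σe) (hσn : 0 < σn) (x : Fin p → ℕ → S) (y : Fin p → ℕ → ℝ)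
include hκ hσe hσn

theorem corrVariance_pos (i : Fin p) (t : ℕ) (z : S) :
    0 < RecursiveGP.corrVariance κ σe σn (x i) (y i) t z :=
  add_pos_of_nonneg_of_pos (RecursiveGP.variance_nonneg hκ hσe _ _ t z) (pow_pos hσn 2)

theorem exists_tendsto_inv_corrVariance (i : Fin p) (z : S) :
    ∃ l, 0 < l ∧
      Tendsto (fun t => (RecursiveGP.corrVariance κ σe σn (x i) (y i) t z)⁻¹) atTop (𝓝 l) := by
  obtain ⟨l, hl0, hl⟩ := RecursiveGP.exists_tendsto_variance hκ hσe (x i) (y i) z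
  have : 0 < l + σn ^ 2 := by positivity
  exact ⟨_, inv_pos.2 this, (hl.add_const _).inv₀ this.ne'⟩

theorem tendsto_increment_reference {c : ℝ} (hc : ∀ z, κ z z ≤ c) {ybar mubar : ℝ}
    (hy : ∀ i t, 1 ≤ t → |y i t| ≤ ybar)
    (hmu : ∀ i t, 1 ≤ t → ∀ z, |RecursiveGP.mean κ σe (x i) (y i) t z| ≤ mubar)
    (z : S) (i : Fin p) (k : Fin 2) :
    Tendsto (fun t => increment (reference κ σe σn x y z) t i k) atTop (𝓝 0) := by
  rw [← tendsto_add_atTop_iff_nat 1]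
  obtain ⟨l, -, hl⟩ := exists_tendsto_inv_corrVariance hκ hσe hσn x y i z
  have hl' := hl.comp (tendsto_add_atTop_nat 1)
  have hdiff := hl'.sub hl
  rw [sub_self] at hdiff
  have hmean := RecursiveGP.tendsto_mean_succ_sub hκ hσe (x i) (y i) hc (hy i) (hmu i) z
  match k with
  | 0 =>
    have hbound := hdiff.abs.const_mul mubar
    rw [abs_zero, mul_zero] at hbound
    -- Product rule for the increment of mean times inverse variance: the mean increment times the
    -- new inverse variance, plus the bounded old mean times the increment of the inverse variance.
    have hsecond : Tendsto (fun t => RecursiveGP.mean κ σe (x i) (y i) t z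
        * ((RecursiveGP.corrVariance κ σe σn (x i) (y i) (t + 1) z)⁻¹
          - (RecursiveGP.corrVariance κ σe σn (x i) (y i) t z)⁻¹)) atTop (𝓝 0) := by
      refine squeeze_zero_norm' ?_ hbound
      filter_upwards [eventually_ge_atTop 1] with t ht
      rw [Real.norm_eq_abs, abs_mul]
      exact mul_le_mul_of_nonneg_right (hmu i t ht z) (abs_nonneg _)
    have := (hmean.mul hl').add hsecond
    rw [zero_mul, add_zero] at this
    refine this.congr fun t => ?_
    simp only [Function.comp_apply, increment, reference, Pi.sub_apply, Matrix.cons_val_zero]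
    ring
  | 1 => exact hdiff.congr fun t => by simp [increment, reference]

theorem abs_poeMean_le (hp : 1 ≤ p) {mubar : ℝ} {t : ℕ} {z : S}
    (hmu : ∀ i, |RecursiveGP.mean κ σe (x i) (y i) t z| ≤ mubar) :
    |poeMean κ σe σn x y t z| ≤ mubar := by
  have : Nonempty (Fin p) := ⟨⟨0, hp⟩⟩
  have hpos := fun i => inv_pos.2 (corrVariance_pos hκ hσe hσn x y i t z)
  have hsum : 0 < ∑ k, (RecursiveGP.corrVariance κ σe σn (x k) (y k) t z)⁻¹ :=
    Finset.sum_pos (fun k _ => hpos k) Finset.univ_nonempty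
  calc |poeMean κ σe σn x y t z|
      ≤ ∑ i, (RecursiveGP.corrVariance κ σe σn (x i) (y i) t z)⁻¹
        / (∑ k, (RecursiveGP.corrVariance κ σe σn (x k) (y k) t z)⁻¹) * mubar := by
        refine (Finset.abs_sum_le_sum_abs _ _).trans (Finset.sum_le_sum fun i _ => ?_)
        have := (div_pos (hpos i) hsum).le
        rw [abs_mul, abs_of_nonneg this]
        exact mul_le_mul_of_nonneg_left (hmu i) this
    _ = mubar := by rw [← Finset.sum_mul, ← Finset.sum_div, div_self hsum.ne', one_mul]

/-- The distributed mean tracks the centralized product-of-experts mean asymptotically. -/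
theorem tendsto_distMean_sub_poeMean (hp : 1 ≤ p) {G : ℕ → Digraph (Fin p)}
    {A : ℕ → Matrix (Fin p) (Fin p) ℝ} (hA : ∀ t, Network.IsWeightedAdjacency (G t) (A t))
    {B : ℕ} (hB : 1 ≤ B) (hconn : Network.PeriodicallyStronglyConnected G B)
    {φ : ℝ} (hφ : 0 < φ) (hnondeg : Network.NonDegenerate G A φ)
    (hstoch : Network.DoublyStochastic A) {c : ℝ} (hc : ∀ z, κ z z ≤ c) {ybar mubar : ℝ}
    (hy : ∀ i t, 1 ≤ t → |y i t| ≤ ybar)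
    (hmu : ∀ i t, 1 ≤ t → ∀ z, |RecursiveGP.mean κ σe (x i) (y i) t z| ≤ mubar)
    (i : Fin p) (z : S) :
    Tendsto (fun t => distMean G A κ σe σn x y i t z - poeMean κ σe σn x y t z)
      atTop (𝓝 0) := by
  have : Nonempty (Fin p) := ⟨i⟩
  have hp0 : (0 : ℝ) < p := by exact_mod_cast hp
  choose l hl0 hl using fun j => exists_tendsto_inv_corrVariance hκ hσe hσn x y j z
  -- Before any data all robots share the prior, with mean 0 and variance `κ z z`.
  have hr : ∀ j k, reference κ σe σn x y z 0 j = reference κ σe σn x y z 0 k := fun j k => by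
    simp [reference, RecursiveGP.mean_zero, RecursiveGP.corrVariance, RecursiveGP.variance_zero]
  have track := fun k => tendsto_consensus_sub_average hp hA hB hconn hφ hnondeg hstoch hr k
    (fun j => tendsto_increment_reference hκ hσe hσn x y hc hy hmu z j k) i
  have hV : Tendsto (fun t => (∑ j, reference κ σe σn x y z t j 1) / p) atTop
      (𝓝 ((∑ j, l j) / p)) := by
    simpa [reference] using (tendsto_finsetSum Finset.univ fun j _ => hl j).div_const (p : ℝ)
  have hlim : (∑ j, l j) / p ≠ 0 :=
    (div_pos (Finset.sum_pos (fun j _ => hl0 j) Finset.univ_nonempty) hp0).ne'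
  refine tendsto_quotient_sub_zero hlim hV (track 1) ?_
    (eventually_atTop.2 ⟨1, fun t ht => abs_poeMean_le hκ hσe hσn x y hp fun j => hmu j t ht z⟩)
  refine (track 0).congr fun t => ?_
  have hsum : 0 < ∑ k, (RecursiveGP.corrVariance κ σe σn (x k) (y k) t z)⁻¹ :=
    Finset.sum_pos (fun k _ => inv_pos.2 (corrVariance_pos hκ hσe hσn x y k t z))
      Finset.univ_nonempty
  -- The product-of-experts mean times the average inverse variance is the average of the first
  -- reference component.
  congr 1
  simp only [poeMean, reference, Matrix.cons_val_zero, Matrix.cons_val_one, Finset.sum_mul,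
    Finset.sum_div]
  refine Finset.sum_congr rfl fun j _ => ?_
  rw [← Finset.sum_div]
  generalize (∑ k, (RecursiveGP.corrVariance κ σe σn (x k) (y k) t z)⁻¹) = W at hsum ⊢
  field_simp

end Reference

theorem eta_nonneg {B : ℕ} (hp : 1 ≤ p) (hB : 1 ≤ B) {φ : ℝ} (hφ : 0 < φ) : 0 ≤ eta p B φ := by
  have : (1 : ℝ) ≤ (p : ℝ) * B := by exact_mod_cast Nat.mul_pos hp hB
  exact div_nonneg (by linarith) (Real.rpow_nonneg hφ.le _)

theorem alphaBound_nonneg {η σe σf σn ybar mubar : ℝ} (hη : 0 ≤ η) (hy : 0 ≤ ybar)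
    (hmu : 0 ≤ mubar) :
    0 ≤ alphaBound η (delta₁ σe σf σn ybar mubar) (delta₂ σe σf σn) := by
  unfold alphaBound delta₁ delta₂
  positivity

end Aggregation

/-! ### The main theorem -/

theorem theorem1
    -- the team of robots, its graphs and its weights
    (p : ℕ) (hp : 1 ≤ p)
    (G : ℕ → Digraph (Fin p)) (A : ℕ → Matrix (Fin p) (Fin p) ℝ)
    (hA : ∀ t, Network.IsWeightedAdjacency (G t) (A t))
    (B : ℕ) (hB : 1 ≤ B) (hconn : Network.PeriodicallyStronglyConnected G B)
    (φ : ℝ) (hφ : 0 < φ) (hnondeg : Network.NonDegenerate G A φ)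
    (hstoch : Network.DoublyStochastic A)
    -- the Gaussian process model: a covariance kernel with variances at most `σf ^ 2`
    (n : ℕ) (X : Set (EuclideanSpace ℝ (Fin n)))
    (κ : X → X → ℝ) (σe σf σn : ℝ) (hσe : 0 < σe) (hσf : 0 < σf) (hσn : 0 < σn)
    (hκ : (Matrix.of κ).PosSemidef) (hκσ : ∀ z, κ z z ≤ σf ^ 2)
    -- the data stream of each robot, bounded together with the local predictions
    (x : Fin p → ℕ → X) (y : Fin p → ℕ → ℝ)
    (ybar mubar : ℝ) (hy : ∀ i t, 1 ≤ t → |y i t| ≤ ybar)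
    (hmu : ∀ i t, 1 ≤ t → ∀ z, |RecursiveGP.mean κ σe (x i) (y i) t z| ≤ mubar)
    -- the choice of the correction bias
    (hbias : Aggregation.eta p B φ * σf ^ 4 / (σe ^ 2 + σf ^ 2) ≤ σn ^ 2) :
    -- the gap converges, and its limit obeys the error bound (void if `β` is infinite)
    (∀ (i : Fin p) (z : X), ∃ gap : ℝ,
      Tendsto (fun t => |Aggregation.distMean G A κ σe σn x y i t z
          - Aggregation.poeMean κ σe σn x y t z|) atTop (𝓝 gap) ∧
      (Aggregation.eta p B φ * Aggregation.delta₂ σe σf σn ≠ 1 →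
        ∀ᶠ t in atTop,
          gap ≤ Aggregation.alphaBound (Aggregation.eta p B φ)
                  (Aggregation.delta₁ σe σf σn ybar mubar) (Aggregation.delta₂ σe σf σn)
              + Aggregation.betaBound (Aggregation.eta p B φ) (Aggregation.delta₂ σe σf σn)
                  * |Aggregation.poeMean κ σe σn x y t z|)) ∧
    -- if the reference inputs eventually vanish, then the gap tends to zero
    (∀ z : X,
      (∃ h : ℕ, 0 < h ∧ ∀ t, h < t → ∀ i,
        Aggregation.increment (Aggregation.reference κ σe σn x y z) (t + 1) i = 0) →
      ∀ i : Fin p,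
        Tendsto (fun t => Aggregation.distMean G A κ σe σn x y i t z
          - Aggregation.poeMean κ σe σn x y t z) atTop (𝓝 0)) := by
  have key := Aggregation.tendsto_distMean_sub_poeMean hκ hσe hσn x y hp hA hB hconn hφ hnondeg
    hstoch hκσ hy hmu
  -- The limit of the gap is 0, so the bound amounts to `α ≥ 0` and `β ≥ 0`, at every `t`.
  refine ⟨fun i z => ⟨0, ?_, fun _ => .of_forall fun t => ?_⟩, fun z _ i => key i z⟩
  · simpa using (key i z).abs
  · have hα := Aggregation.alphaBound_nonneg (σe := σe) (σf := σf) (σn := σn)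
      (Aggregation.eta_nonneg hp hB hφ) ((abs_nonneg _).trans (hy i 1 le_rfl))
      ((abs_nonneg _).trans (hmu i 1 le_rfl z))
    exact add_nonneg hα (mul_nonneg (abs_nonneg _) (abs_nonneg _))
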